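/- Let $(\Omega,\mathcal F,\mathbb F,\check{\mathbb Q})$, $\mathbb F=(\mathcal F_t)_{t\ge 0}$, be a filtered probability space satisfying the usual conditions: $\mathbb F$ is right-continuous and $\mathcal F_0$ contains all $\check{\mathbb Q}$-null sets (subsets of measurable sets of $\check{\mathbb Q}$-measure zero). Let $\check Z=(\check Z_t)_{t\ge 0}$ be a non-negative, uniformly integrable $(\mathbb F,\check{\mathbb Q})$-martingale with càdlàg paths and $\check Z_0=1$. Put $\mathcal F_\infty:=\bigvee_{t\ge 0}\mathcal F_t$ and, for $n\ge 1$, $$\tau_n:=\inf\{t\ge 0:\check Z_t<1/n\}\quad(\inf\varnothing=\infty),\qquad \tau:=\lim_{n\to\infty}\tau_n .$$ Path properties (non-negativity, càdlàg, initial value) are understood up to null sets of the respective measure. Then there is a unique measure $\mathbb Q$ on $\mathcal F_\infty$ with $\frac{d\mathbb Q}{d\check{\mathbb Q}}\big|_{\mathcal F_t}=\check Z_t$ for all $t\ge 0$, i.e. $\mathbb Q[A]=E_{\check{\mathbb Q}}[\check Z_t\mathbf 1_A]$ for all $t\ge 0$ and $A\in\mathcal F_t$; each $\tau_n$ is an $\mathbb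 F$-stopping time; and, with $Z:=1/\check Z$ (which is well defined $\mathbb Q$-a.s.; its value where $\check Z=0$ is irrelevant and may be set to $0$), $(\check{\mathbb Q},\tau)$ is a Föllmer pair for $Z$ under $\mathbb Q$ on $\mathcal F_\infty$. That is: $\mathbb Q$ is a probability measure; $Z$ is a non-negative $(\mathbb F,\mathbb Q)$-supermartingale with càdlàg paths and $Z_0=1$; $\tau$ is an $\mathbb F$-stopping time with $\mathbb Q[\tau=\infty]=1$; and $$\check{\mathbb Q}\big[A\cap\{\tau>t\}\big]=E_{\mathbb Q}\big[Z_t\mathbf 1_A\big]\qquad\text{for all }t\ge 0,\ A\in\mathcal F_t .$$ Moreover: 1. $Z$ is an $(\mathbb F,\mathbb Q)$-local martingale if and only if $\check{\mathbb Q}\big[\tau<\infty,\ \check Z_{\tau-}\ne 0\big]=0$, i.e. $\check Z$ does not jump to zero $\check{\mathbb Q}$-a.s. 2. $Z$ is a true $(\mathbb F,\mathbb Q)$-martingale if and only if $\check Z$ is strictly positive $\check{\mathbb Q}$-a.s., i.e. $\check{\mathbb Q}\big[\check Z_t>0\text{ for all }t\in[0,\infty)\big]=1$. -/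

import Mathlib

open MeasureTheory ProbabilityTheory Filter Set
open scoped NNReal ENNReal Topology

namespace FoellmerPair

noncomputable section

/-- The usual conditions for a filtered probability space: the filtration is right-continuous and
its initial sigma-algebra contains every subset of a null set. -/
structure UsualConditions {Ω : Type*} {m : MeasurableSpace Ω} (𝓕 : Filtration ℝ≥0 m)
    (P : Measure Ω) : Prop where
  rightContinuous : 𝓕.IsRightContinuous
  complete : ∀ N : Set Ω, P N = 0 → MeasurableSet[𝓕 0] N

/-- Right-continuity with left limits, for a real function on the half-line. -/
def IsCadlag (f : ℝ≥0 → ℝ) : Prop :=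
  ∀ t, ContinuousWithinAt f (Ioi t) t ∧ ∃ l : ℝ, Tendsto f (𝓝[<] t) (𝓝 l)

/-- The terminal sigma-algebra generated by all the members of the filtration. -/
abbrev terminal {Ω : Type*} {m : MeasurableSpace Ω} (𝓕 : Filtration ℝ≥0 m) : MeasurableSpace Ω :=
  ⨆ t, 𝓕 t

theorem terminal_le {Ω : Type*} {m : MeasurableSpace Ω} (𝓕 : Filtration ℝ≥0 m) :
    terminal 𝓕 ≤ m :=
  iSup_le 𝓕.le

/-- The same filtration, seen as a filtration of its terminal sigma-algebra. -/
def onTerminal {Ω : Type*} {m : MeasurableSpace Ω} (𝓕 : Filtration ℝ≥0 m) :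
    Filtration ℝ≥0 (terminal 𝓕) where
  seq t := 𝓕 t
  mono' _ _ h := 𝓕.mono h
  le' t := le_iSup (fun s => 𝓕 s) t

/-- `Q`, a measure on the terminal sigma-algebra, has density process `X` with respect to `P`: on
each member of the filtration at time `t`, the density of `Q` relative to `P` is `X t`. -/
def HasDensityProcess {Ω : Type*} {m : MeasurableSpace Ω} (𝓕 : Filtration ℝ≥0 m)
    (P : Measure Ω) (X : ℝ≥0 → Ω → ℝ) (Q : @Measure Ω (terminal 𝓕)) : Prop :=
  ∀ (t : ℝ≥0) (A : Set Ω), MeasurableSet[𝓕 t] A → Q A = ∫⁻ ω in A, ENNReal.ofReal (X t ω) ∂P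

/-- `hitBelow X n` is the first time at which `X` is strictly below the level `1 / (n + 1)`, with
the value `⊤` if there is no such time. -/
def hitBelow {Ω : Type*} (X : ℝ≥0 → Ω → ℝ) (n : ℕ) : Ω → WithTop ℝ≥0 :=
  hittingAfter X (Iio (1 / ((n : ℝ) + 1))) 0

/-- The limit of the (non-decreasing) hitting times `hitBelow X n`. -/
def hitLimit {Ω : Type*} (X : ℝ≥0 → Ω → ℝ) : Ω → WithTop ℝ≥0 :=
  fun ω => ⨆ n : ℕ, hitBelow X n ω

theorem tendsto_hitBelow {Ω : Type*} (X : ℝ≥0 → Ω → ℝ) (ω : Ω) :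
    Tendsto (fun n => hitBelow X n ω) atTop (𝓝 (hitLimit X ω)) := by
  refine tendsto_atTop_iSup fun a b hab => ?_
  exact hittingAfter_anti X 0 (Iio_subset_Iio (Nat.one_div_le_one_div hab)) ω

/-- Local martingales: along some localizing sequence the stopped processes are martingales. -/
def IsLocalMartingale {Ω : Type*} {m : MeasurableSpace Ω} (X : ℝ≥0 → Ω → ℝ)
    (𝓕 : Filtration ℝ≥0 m) (P : Measure Ω) : Prop :=
  Locally (fun Y : ℝ≥0 → Ω → ℝ => Martingale Y 𝓕 P) 𝓕 X P

/-- `(R, τ)` is a Föllmer pair for the non-negative càdlàg `Q`-supermartingale `Z` started in one.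
Path properties are understood up to a `Q`-null set. -/
structure IsFoellmerPair {Ω : Type*} {m : MeasurableSpace Ω} (𝓕 : Filtration ℝ≥0 m)
    (Q : Measure Ω) (Z : ℝ≥0 → Ω → ℝ) (R : Measure Ω) (τ : Ω → WithTop ℝ≥0) : Prop where
  isProbabilityMeasure_left : IsProbabilityMeasure Q
  isProbabilityMeasure_right : IsProbabilityMeasure R
  supermartingale : Supermartingale Z 𝓕 Q
  nonneg : ∀ᵐ ω ∂Q, ∀ t, 0 ≤ Z t ω
  cadlag : ∀ᵐ ω ∂Q, IsCadlag fun t => Z t ω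
  initial : ∀ᵐ ω ∂Q, Z 0 ω = 1
  isStoppingTime : IsStoppingTime 𝓕 τ
  ae_eq_top : ∀ᵐ ω ∂Q, τ ω = ⊤
  measure_eq : ∀ (t : ℝ≥0) (A : Set Ω), MeasurableSet[𝓕 t] A →
    R (A ∩ {ω | (t : WithTop ℝ≥0) < τ ω}) = ∫⁻ ω in A, ENNReal.ofReal (Z t ω) ∂Q

end

end FoellmerPair

namespace FoellmerPair

/-! Write `P` for the original measure, `X` for its density martingale, `τₙ` for `hitBelow X n` and
`τ` for `hitLimit X`. A uniformly integrable martingale is closed by its limit, and that limit is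
the density of `Q` on the terminal sigma-algebra. Optional sampling turns the density at fixed times
into a density at stopping times: `Q B = E_P[X_{σ∧t}; B]` for `B ∈ 𝓕_{σ∧t}`. Integrating the
reciprocal gives `E_Q[1 / X_{σ∧t}; B] = P(B ∩ {X_{σ∧t} > 0})` (`setLIntegral_inv_stoppedProcess`),
so questions about `1 / X` under `Q` become questions about the zeros of `X` under `P`. Since `X ≤
1/(n+1)` at `τₙ`, `Q(τₙ ≤ t) ≤ 1/(n+1)`, hence `τ = ∞` `Q`-a.s. Read under `P`, this says that `X`
vanishes from `τ` on. So `{X_t > 0} = {τ > t}` up to a null set, which is the Föllmer identity; `1 /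
X` is a martingale exactly when no mass is lost, that is, when `P(τ > t) = 1` for all `t`. If `X`
does not jump to zero, it is still positive at `τₙ`, so stopping at `τₙ` loses no mass and `(τₙ)`
localizes `1 / X`. Conversely, a localizing sequence `(σₖ)` must satisfy `σₖ < τ` on `{τ < ∞}`,
`P`-a.s. It tends to infinity only under `Q`, but on `{τₙ = τ < N}` one has `X ≥ 1/(n+1)` at `σₖ`,
so the `P`-mass of this event is at most `(n+1) Q(σₖ < N) → 0`. Hence `τₙ < τ` for all `n`, and the
left limit of `X` at `τ` is zero (`ae_hitBelow_lt_hitLimit`, `leftLim_eq_zero_of_hitBelow_lt`). -/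

theorem untopA_coe {ι : Type*} [Nonempty ι] (s : ι) : (s : WithTop ι).untopA = s := rfl

/-! ### Discretisation of time from above -/

/-- The least point of the grid `(1 / (k + 1)) ℕ` that is strictly above `s`. -/
noncomputable def gridAbove (k : ℕ) (s : ℝ≥0) : ℝ≥0 := (⌊s * (k + 1)⌋₊ + 1) / (k + 1)

theorem lt_gridAbove (k : ℕ) (s : ℝ≥0) : s < gridAbove k s := by
  rw [gridAbove, lt_div_iff₀ (by positivity)]
  exact Nat.lt_floor_add_one _

theorem gridAbove_le (k : ℕ) (s : ℝ≥0) : gridAbove k s ≤ s + 1 / (k + 1) := by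
  rw [gridAbove, add_div]
  gcongr
  rw [div_le_iff₀ (by positivity)]
  exact Nat.floor_le (by positivity)

/-- The right side compares `s` with the last grid point not above `i`; this is why rounding a
stopping time up to the grid gives a stopping time. -/
theorem gridAbove_le_iff (k : ℕ) (s i : ℝ≥0) :
    gridAbove k s ≤ i ↔ s < ⌊i * (k + 1)⌋₊ / (k + 1) := by
  rw [gridAbove, div_le_iff₀ (by positivity), lt_div_iff₀ (by positivity), ← Nat.cast_add_one,
    ← Nat.le_floor_iff (by positivity), Nat.add_one_le_iff, Nat.floor_lt (by positivity)]

theorem tendsto_gridAbove (s : ℝ≥0) : Tendsto (fun k => gridAbove k s) atTop (𝓝 s) := by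
  refine tendsto_of_tendsto_of_tendsto_of_le_of_le tendsto_const_nhds (h := fun k : ℕ =>
    s + 1 / ((k : ℝ≥0) + 1)) ?_ (fun k => (lt_gridAbove k s).le) (fun k => gridAbove_le k s)
  simpa using tendsto_const_nhds.add (tendsto_one_div_add_atTop_nhds_zero_nat (𝕜 := ℝ≥0))

theorem tendsto_comp_min_gridAbove {f : ℝ≥0 → ℝ} {s t : ℝ≥0}
    (hf : ContinuousWithinAt f (Ioi s) s) (hst : s ≤ t) :
    Tendsto (fun k => f (min t (gridAbove k s))) atTop (𝓝 (f s)) := by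
  have h : Tendsto f (𝓝[≥] s) (𝓝 (f s)) := continuousWithinAt_Ioi_iff_Ici.1 hf
  refine h.comp (tendsto_nhdsWithin_iff.2 ⟨?_, Eventually.of_forall fun k =>
    le_min hst (lt_gridAbove k s).le⟩)
  simpa [min_eq_right hst] using (tendsto_const_nhds (x := t)).min (tendsto_gridAbove s)

theorem measurable_floor_mul (k : ℕ) : Measurable fun s : ℝ≥0 => ⌊s * (k + 1)⌋₊ :=
  Nat.measurable_floor.comp (measurable_id.mul_const _)

theorem measurable_comp_gridAbove {Ω : Type*} [MeasurableSpace Ω] {t : ℝ≥0} {Y : ℝ≥0 → Ω → ℝ}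
    (hY : ∀ s ≤ t, Measurable (Y s)) (k : ℕ) :
    Measurable fun p : Iic t × Ω => Y (min t (gridAbove k p.1)) p.2 := by
  have h : Measurable fun q : ℕ × Ω => Y (min t ((q.1 + 1) / (k + 1))) q.2 :=
    measurable_from_prod_countable_right fun n => hY (min t ((n + 1) / (k + 1))) (min_le_left _ _)
  have h₁ : Measurable fun p : Iic t × Ω => ⌊(p.1 : ℝ≥0) * (k + 1)⌋₊ :=
    (measurable_floor_mul k).comp (measurable_subtype_coe.comp measurable_fst)
  have h₂ : Measurable fun p : Iic t × Ω => (⌊(p.1 : ℝ≥0) * (k + 1)⌋₊, p.2) :=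
    h₁.prodMk measurable_snd
  simpa only [gridAbove, Function.comp_def] using h.comp h₂

section Sampling

variable {Ω : Type*} {m : MeasurableSpace Ω} {𝓕 : Filtration ℝ≥0 m}

theorem isStronglyProgressive_of_rightContinuous {Y : ℝ≥0 → Ω → ℝ} (hY : StronglyAdapted 𝓕 Y)
    (hc : ∀ ω t, ContinuousWithinAt (fun s => Y s ω) (Ioi t) t) : IsStronglyProgressive 𝓕 Y := by
  refine IsProgressive.isStronglyProgressive fun t => ?_
  -- Capping the rounded time at `t` keeps the approximations `𝓕 t`-measurable; right-continuity
  -- gives the limit.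
  refine @measurable_of_tendsto_metrizable (Iic t × Ω) ℝ (_) _ _ _ _ (fun k p =>
    Y (min t (gridAbove k p.1)) p.2) _ (fun k => ?_) ?_
  · exact @measurable_comp_gridAbove Ω (𝓕 t) t Y
      (fun s hs => ((hY s).mono (𝓕.mono hs)).measurable) k
  · rw [tendsto_pi_nhds]
    exact fun p => tendsto_comp_min_gridAbove (hc p.2 p.1) p.1.2

theorem isStoppingTime_gridAbove {σ : Ω → WithTop ℝ≥0} (hσ : IsStoppingTime 𝓕 σ) {t : ℝ≥0}
    (hσt : ∀ ω, σ ω ≤ t) (k : ℕ) :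
    IsStoppingTime 𝓕 fun ω => ((min t (gridAbove k (σ ω).untopA) : ℝ≥0) : WithTop ℝ≥0) := by
  have h : IsStoppingTime 𝓕 fun ω => ((gridAbove k (σ ω).untopA : ℝ≥0) : WithTop ℝ≥0) := by
    intro i
    have hj : (⌊i * (k + 1)⌋₊ / (k + 1) : ℝ≥0) ≤ i := by
      rw [div_le_iff₀ (by positivity)]
      exact Nat.floor_le (by positivity)
    convert! 𝓕.mono hj _ (hσ.measurableSet_lt (⌊i * (k + 1)⌋₊ / (k + 1))) using 1
    ext ω
    obtain ⟨s, hs⟩ := WithTop.ne_top_iff_exists.1 ((hσt ω).trans_lt (WithTop.coe_lt_top t)).ne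
    change ((gridAbove k (σ ω).untopA : ℝ≥0) : WithTop ℝ≥0) ≤ i ↔ σ ω < _
    rw [← hs, untopA_coe, WithTop.coe_le_coe, WithTop.coe_lt_coe, gridAbove_le_iff]
  convert! (isStoppingTime_const 𝓕 t).min h using 2

/-! ### Completeness of the filtration -/

variable {P : Measure Ω}

/-- The two sets differ by null sets, which completeness places in `𝓕 0`. This lets path properties
that hold only almost surely be used for measurability. -/
theorem UsualConditions.measurableSet_congr (hu : UsualConditions 𝓕 P) {G : MeasurableSpace Ω}
    (hG : 𝓕 0 ≤ G) {A B : Set Ω} (h : A =ᵐ[P] B) (hA : MeasurableSet[G] A) :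
    MeasurableSet[G] B := by
  have h' := ae_eq_set.1 h
  have : B = (A ∪ B \ A) \ (A \ B) := by ext; simp; tauto
  rw [this]
  exact (hA.union (hG _ (hu.complete _ h'.2))).diff (hG _ (hu.complete _ h'.1))

theorem UsualConditions.measurable_congr (hu : UsualConditions 𝓕 P) {G : MeasurableSpace Ω}
    (hG : 𝓕 0 ≤ G) {β : Type*} [MeasurableSpace β] {f g : Ω → β} (h : f =ᵐ[P] g)
    (hf : Measurable[G] f) : Measurable[G] g := fun s hs =>
  hu.measurableSet_congr hG (h.preimage s) (hf hs)

theorem zero_le_measurableSpace {σ : Ω → WithTop ℝ≥0} (hσ : IsStoppingTime 𝓕 σ) :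
    𝓕 0 ≤ hσ.measurableSpace :=
  hσ.le_measurableSpace_of_const_le fun _ => bot_le

/-- An adapted process with almost surely right-continuous paths has a strongly progressive
version. -/
theorem UsualConditions.exists_stronglyProgressive (hu : UsualConditions 𝓕 P)
    {X : ℝ≥0 → Ω → ℝ} (hX : StronglyAdapted 𝓕 X)
    (hc : ∀ᵐ ω ∂P, ∀ t, ContinuousWithinAt (fun s => X s ω) (Ioi t) t) :
    ∃ Y : ℝ≥0 → Ω → ℝ, IsStronglyProgressive 𝓕 Y ∧ ∀ᵐ ω ∂P, ∀ t, Y t ω = X t ω := by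
  classical
  refine ⟨fun t ω => if ∀ t, ContinuousWithinAt (fun s => X s ω) (Ioi t) t then X t ω else 0,
    isStronglyProgressive_of_rightContinuous (fun t => ?_) fun ω t => ?_, ?_⟩
  · refine (hu.measurable_congr (𝓕.mono bot_le) ?_ (hX t).measurable).stronglyMeasurable
    filter_upwards [hc] with ω hω using (if_pos hω).symm
  · by_cases hω : ∀ t, ContinuousWithinAt (fun s => X s ω) (Ioi t) t
    · simpa only [if_pos hω] using hω t
    · simpa only [if_neg hω] using continuousWithinAt_const
  · filter_upwards [hc] with ω hω t using if_pos hω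

theorem UsualConditions.measurable_stoppedValue (hu : UsualConditions 𝓕 P)
    {X : ℝ≥0 → Ω → ℝ} (hX : StronglyAdapted 𝓕 X)
    (hc : ∀ᵐ ω ∂P, ∀ t, ContinuousWithinAt (fun s => X s ω) (Ioi t) t)
    {σ : Ω → WithTop ℝ≥0} (hσ : IsStoppingTime 𝓕 σ) :
    Measurable[hσ.measurableSpace] (stoppedValue X σ) := by
  obtain ⟨Y, hY, hYX⟩ := hu.exists_stronglyProgressive hX hc
  refine hu.measurable_congr (zero_le_measurableSpace hσ) ?_
    (MeasureTheory.measurable_stoppedValue hY hσ)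
  filter_upwards [hYX] with ω hω using hω _

/-! ### Optional sampling for right-continuous martingales -/

/-- Sampling at the countably valued times `ρ k ↓ σ` gives conditional expectations of the single
variable `X t`, a uniformly integrable family. Right-continuity gives almost sure convergence, hence
convergence in `L¹`, and `𝓕_σ ⊆ 𝓕_{ρ k}` lets `B` be tested along the sequence. -/
theorem setIntegral_stoppedValue [IsFiniteMeasure P] {X : ℝ≥0 → Ω → ℝ} (hX : Martingale X 𝓕 P)
    (hc : ∀ᵐ ω ∂P, ∀ t, ContinuousWithinAt (fun s => X s ω) (Ioi t) t)
    {σ : Ω → WithTop ℝ≥0} (hσ : IsStoppingTime 𝓕 σ) {t : ℝ≥0} (hσt : ∀ ω, σ ω ≤ t) :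
    Integrable (stoppedValue X σ) P ∧
    ∀ B, MeasurableSet[hσ.measurableSpace] B →
      ∫ ω in B, stoppedValue X σ ω ∂P = ∫ ω in B, X t ω ∂P := by
  set ρ : ℕ → Ω → WithTop ℝ≥0 :=
    fun k ω => ((min t (gridAbove k (σ ω).untopA) : ℝ≥0) : WithTop ℝ≥0) with hρ
  have hρs k : IsStoppingTime 𝓕 (ρ k) := isStoppingTime_gridAbove hσ hσt k
  have hρt k ω : ρ k ω ≤ t := WithTop.coe_le_coe.2 (min_le_left _ _)
  have hσρ k : σ ≤ ρ k := fun ω => by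
    have := hσt ω
    simp only [hρ]
    obtain ⟨s, hs⟩ := WithTop.ne_top_iff_exists.1 (this.trans_lt (WithTop.coe_lt_top t)).ne
    rw [← hs] at this ⊢
    rw [untopA_coe]
    exact WithTop.coe_le_coe.2 (le_min (WithTop.coe_le_coe.1 this) (lt_gridAbove k s).le)
  have hcount k : (Set.range (ρ k)).Countable := by
    refine (countable_range fun n : ℕ =>
      ((min t ((n + 1) / (k + 1)) : ℝ≥0) : WithTop ℝ≥0)).mono ?_
    rintro _ ⟨ω, rfl⟩
    exact ⟨⌊(σ ω).untopA * (k + 1)⌋₊, rfl⟩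
  have hcond k : stoppedValue X (ρ k) =ᵐ[P] P[X t | (hρs k).measurableSpace] :=
    hX.stoppedValue_ae_eq_condExp_of_le_const_of_countable_range (hρs k) (hρt k) (hcount k)
  have hlim : ∀ᵐ ω ∂P, Tendsto (fun k => stoppedValue X (ρ k) ω) atTop
      (𝓝 (stoppedValue X σ ω)) := by
    filter_upwards [hc] with ω hω
    refine tendsto_comp_min_gridAbove (hω _) ?_
    exact WithTop.untopA_le (hσt ω)
  have hUI : UniformIntegrable (fun k => stoppedValue X (ρ k)) 1 P :=
    ((hX.integrable t).uniformIntegrable_condExp fun k => (hρs k).measurableSpace_le).ae_eq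
      fun k => (hcond k).symm
  have hint : MemLp (stoppedValue X σ) 1 P := hUI.memLp_of_ae_tendsto hlim
  refine ⟨memLp_one_iff_integrable.1 hint, fun B hB => ?_⟩
  have hL1 := tendsto_Lp_finite_of_tendsto_ae le_rfl ENNReal.one_ne_top hUI.1 hint hUI.2.1 hlim
  have hconv := tendsto_setIntegral_of_L1' (stoppedValue X σ) hint.1
    (Eventually.of_forall fun k => memLp_one_iff_integrable.1 (hUI.memLp k)) hL1 B
  refine tendsto_nhds_unique hconv (tendsto_const_nhds.congr fun k => ?_)
  rw [setIntegral_congr_ae (g := P[X t | (hρs k).measurableSpace])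
    ((hρs k).measurableSpace_le _ (hσ.measurableSpace_mono (hρs k) (hσρ k) _ hB))
    ((hcond k).mono fun _ h _ => h), setIntegral_condExp (hρs k).measurableSpace_le
    (hX.integrable t) (hσ.measurableSpace_mono (hρs k) (hσρ k) _ hB)]

theorem ofReal_setIntegral (A : Set Ω) {f : Ω → ℝ}
    (hf : Integrable f P) (h0 : ∀ᵐ ω ∂P, 0 ≤ f ω) :
    ENNReal.ofReal (∫ ω in A, f ω ∂P) = ∫⁻ ω in A, ENNReal.ofReal (f ω) ∂P :=
  ofReal_integral_eq_lintegral_ofReal hf.integrableOn (ae_restrict_of_ae h0)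

theorem setLIntegral_stoppedValue [IsFiniteMeasure P] {X : ℝ≥0 → Ω → ℝ} (hX : Martingale X 𝓕 P)
    (h0 : ∀ᵐ ω ∂P, ∀ t, 0 ≤ X t ω)
    (hc : ∀ᵐ ω ∂P, ∀ t, ContinuousWithinAt (fun s => X s ω) (Ioi t) t)
    {σ : Ω → WithTop ℝ≥0} (hσ : IsStoppingTime 𝓕 σ) {t : ℝ≥0} (hσt : ∀ ω, σ ω ≤ t)
    {B : Set Ω} (hB : MeasurableSet[hσ.measurableSpace] B) :
    ∫⁻ ω in B, ENNReal.ofReal (stoppedValue X σ ω) ∂P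
      = ∫⁻ ω in B, ENNReal.ofReal (X t ω) ∂P := by
  obtain ⟨h1, h2⟩ := setIntegral_stoppedValue hX hc hσ hσt
  rw [← ofReal_setIntegral B h1 (h0.mono fun ω h => h _),
    ← ofReal_setIntegral B (hX.integrable t) (h0.mono fun ω h => h _), h2 B hB]

end Sampling

/-! ### Martingales through Lebesgue integrals -/

section Lebesgue

variable {Ω : Type*} {m : MeasurableSpace Ω} {𝓖 : Filtration ℝ≥0 m} {μ : Measure Ω}

theorem integrable_of_lintegral_ofReal_ne_top {f : Ω → ℝ} (hf : AEStronglyMeasurable f μ)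
    (h0 : ∀ᵐ ω ∂μ, 0 ≤ f ω) (h : ∫⁻ ω, ENNReal.ofReal (f ω) ∂μ ≠ ⊤) : Integrable f μ :=
  ⟨hf, (hasFiniteIntegral_iff_ofReal h0).2 h.lt_top⟩

theorem supermartingale_of_setLIntegral_le [IsFiniteMeasure μ] {f : ℝ≥0 → Ω → ℝ}
    (hf : StronglyAdapted 𝓖 f) (h0 : ∀ t, ∀ᵐ ω ∂μ, 0 ≤ f t ω)
    (hfin : ∀ t, ∫⁻ ω, ENNReal.ofReal (f t ω) ∂μ ≠ ⊤)
    (hle : ∀ s t, s ≤ t → ∀ A, MeasurableSet[𝓖 s] A →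
      ∫⁻ ω in A, ENNReal.ofReal (f t ω) ∂μ ≤ ∫⁻ ω in A, ENNReal.ofReal (f s ω) ∂μ) :
    Supermartingale f 𝓖 μ := by
  have hint t : Integrable (f t) μ := integrable_of_lintegral_ofReal_ne_top
    ((hf t).mono (𝓖.le t)).aestronglyMeasurable (h0 t) (hfin t)
  rw [← neg_neg f]
  refine (submartingale_of_setIntegral_le hf.neg (fun t => (hint t).neg) fun s t hst A hA => ?_).neg
  simp only [Pi.neg_apply, integral_neg, neg_le_neg_iff]
  have hs : 0 ≤ ∫ ω in A, f s ω ∂μ := integral_nonneg_of_ae (ae_restrict_of_ae (h0 s))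
  rw [← ENNReal.ofReal_le_ofReal_iff hs, ofReal_setIntegral A (hint t) (h0 t),
    ofReal_setIntegral A (hint s) (h0 s)]
  exact hle s t hst A hA

theorem martingale_of_setLIntegral_eq [IsFiniteMeasure μ] {f : ℝ≥0 → Ω → ℝ}
    (hf : StronglyAdapted 𝓖 f) (h0 : ∀ t, ∀ᵐ ω ∂μ, 0 ≤ f t ω)
    (hfin : ∀ t, ∫⁻ ω, ENNReal.ofReal (f t ω) ∂μ ≠ ⊤)
    (heq : ∀ s t, s ≤ t → ∀ A, MeasurableSet[𝓖 s] A →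
      ∫⁻ ω in A, ENNReal.ofReal (f t ω) ∂μ = ∫⁻ ω in A, ENNReal.ofReal (f s ω) ∂μ) :
    Martingale f 𝓖 μ := by
  have hint t : Integrable (f t) μ := integrable_of_lintegral_ofReal_ne_top
    ((hf t).mono (𝓖.le t)).aestronglyMeasurable (h0 t) (hfin t)
  refine martingale_iff.2 ⟨supermartingale_of_setLIntegral_le hf h0 hfin
    fun s t hst A hA => (heq s t hst A hA).le,
    submartingale_of_setIntegral_le hf hint fun s t hst A hA => ?_⟩
  have ht : 0 ≤ ∫ ω in A, f t ω ∂μ := integral_nonneg_of_ae (ae_restrict_of_ae (h0 t))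
  rw [← ENNReal.ofReal_le_ofReal_iff ht, ofReal_setIntegral A (hint t) (h0 t),
    ofReal_setIntegral A (hint s) (h0 s)]
  exact (heq s t hst A hA).ge

theorem lintegral_ofReal_eq_of_martingale [IsFiniteMeasure μ] {f : ℝ≥0 → Ω → ℝ}
    (hf : Martingale f 𝓖 μ) (h0 : ∀ t, ∀ᵐ ω ∂μ, 0 ≤ f t ω) (t : ℝ≥0) :
    ∫⁻ ω, ENNReal.ofReal (f t ω) ∂μ = ∫⁻ ω, ENNReal.ofReal (f 0 ω) ∂μ := by
  have h := hf.setIntegral_eq (zero_le (a := t)) MeasurableSet.univ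
  rw [setIntegral_univ, setIntegral_univ] at h
  rw [← ofReal_integral_eq_lintegral_ofReal (hf.integrable t) (h0 t),
    ← ofReal_integral_eq_lintegral_ofReal (hf.integrable 0) (h0 0), h]

end Lebesgue

/-! ### Change of measure on a sub-sigma-algebra -/

theorem lintegral_eq_lintegral_mul_density {Ω : Type*} {G m' m : MeasurableSpace Ω} (hG : G ≤ m')
    (hm : m' ≤ m) {Q : @Measure Ω m'} {P : Measure Ω} {f : Ω → ℝ≥0∞} (hf : Measurable f)
    (h : ∀ B, MeasurableSet[G] B → Q B = ∫⁻ ω in B, f ω ∂P) {g : Ω → ℝ≥0∞}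
    (hg : Measurable[G] g) : ∫⁻ ω, g ω ∂Q = ∫⁻ ω, g ω * f ω ∂P := by
  have hQ : Q.trim hG = (P.withDensity f).trim (hG.trans hm) := by
    refine @Measure.ext _ G _ _ fun B hB => ?_
    rw [trim_measurableSet_eq hG hB, trim_measurableSet_eq _ hB,
      withDensity_apply _ (hm _ (hG _ hB)), h B hB]
  rw [← lintegral_trim hG hg, hQ, lintegral_trim _ hg,
    lintegral_withDensity_eq_lintegral_mul _ hf (hg.mono (hG.trans hm) le_rfl)]
  exact lintegral_congr fun ω => mul_comm _ _

/-- The product of the density and its reciprocal is the indicator of `{0 < f}`; where `f ≤ 0` the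
density factor is zero. -/
theorem setLIntegral_inv_density {Ω : Type*} {G m' m : MeasurableSpace Ω} (hG : G ≤ m')
    (hm : m' ≤ m) {Q : @Measure Ω m'} {P : Measure Ω} {f : Ω → ℝ} (hf : Measurable[G] f)
    (h : ∀ B, MeasurableSet[G] B → Q B = ∫⁻ ω in B, ENNReal.ofReal (f ω) ∂P) {B : Set Ω}
    (hB : MeasurableSet[G] B) :
    ∫⁻ ω in B, ENNReal.ofReal (f ω)⁻¹ ∂Q = P (B ∩ {ω | 0 < f ω}) := by
  have hf' : Measurable f := hf.mono (hG.trans hm) le_rfl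
  have hpos : MeasurableSet {ω | 0 < f ω} := measurableSet_lt measurable_const hf'
  rw [← lintegral_indicator (hG _ hB),
    lintegral_eq_lintegral_mul_density hG hm hf'.ennreal_ofReal h
      (g := B.indicator fun ω => ENNReal.ofReal (f ω)⁻¹) (hf.inv.ennreal_ofReal.indicator hB),
    ← lintegral_indicator_one ((hm _ (hG _ hB)).inter hpos)]
  refine lintegral_congr fun ω => ?_
  by_cases hω : ω ∈ B
  · by_cases h0 : 0 < f ω
    · rw [indicator_of_mem hω, indicator_of_mem (show ω ∈ B ∩ {ω | 0 < f ω} from ⟨hω, h0⟩),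
        ← ENNReal.ofReal_mul (by positivity),
        inv_mul_cancel₀ h0.ne']
      simp
    · rw [ENNReal.ofReal_of_nonpos (not_lt.1 h0), mul_zero, indicator_of_notMem fun h => h0 h.2]
  · rw [indicator_of_notMem hω, zero_mul, indicator_of_notMem fun h => hω h.1]

section Density

variable {Ω : Type*} {m : MeasurableSpace Ω} {𝓕 : Filtration ℝ≥0 m} {P : Measure Ω}
  {X : ℝ≥0 → Ω → ℝ} {Q : @Measure Ω (terminal 𝓕)}

/-! ### Existence and uniqueness of the measure with a given density process -/

/-- Integer times suffice: the limit `Y` closes the sampled martingale, and a real time `t` is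
reached through some `n ≥ t`. -/
theorem exists_hasDensityProcess [IsFiniteMeasure P] (hX : Martingale X 𝓕 P)
    (hui : UniformIntegrable X 1 P) (h0 : ∀ᵐ ω ∂P, ∀ t, 0 ≤ X t ω) :
    ∃ Q : @Measure Ω (terminal 𝓕), HasDensityProcess 𝓕 P X Q := by
  let 𝓖 : Filtration ℕ m := ⟨fun n => 𝓕 n, fun i j h => 𝓕.mono (by exact_mod_cast h),
    fun n => 𝓕.le n⟩
  have hXn : Martingale (fun n : ℕ => X n) 𝓖 P :=
    ⟨fun n => hX.stronglyAdapted n, fun i j h => hX.2 i j (by exact_mod_cast h)⟩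
  have hun : UniformIntegrable (fun n : ℕ => X n) 1 P := by
    obtain ⟨h1, h2, C, hC⟩ := hui
    refine ⟨fun n => h1 n, fun ε hε => ?_, C, fun n => hC n⟩
    obtain ⟨δ, hδ, h⟩ := h2 hε
    exact ⟨δ, hδ, fun n => h n⟩
  set Y := Filtration.limitProcess (fun n : ℕ => X n) 𝓖 P
  have hlim := hXn.submartingale.ae_tendsto_limitProcess_of_uniformIntegrable hun
  have hYint : Integrable Y P := hun.integrable_of_ae_tendsto hlim
  have hY0 : ∀ᵐ ω ∂P, 0 ≤ Y ω := by
    filter_upwards [hlim, h0] with ω hω h0 using ge_of_tendsto' hω fun n => h0 n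
  refine ⟨(P.withDensity fun ω => ENNReal.ofReal (Y ω)).trim (terminal_le 𝓕), fun t A hA => ?_⟩
  have hA' : MeasurableSet[terminal 𝓕] A := le_iSup (fun s => 𝓕 s) t A hA
  obtain ⟨n, hn⟩ := exists_nat_ge t
  rw [trim_measurableSet_eq _ hA', withDensity_apply _ (𝓕.le t _ hA),
    ← ofReal_setIntegral A hYint hY0,
    ← ofReal_setIntegral A (hX.integrable t) (h0.mono fun ω h => h t),
    hX.setIntegral_eq hn hA, ← setIntegral_condExp (𝓕.le n) hYint (𝓕.mono hn _ hA)]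
  congr 1
  refine setIntegral_congr_ae (𝓕.le t _ hA) ?_
  filter_upwards [hXn.ae_eq_condExp_limitProcess hun n] with ω hω _ using hω.symm

theorem HasDensityProcess.unique [IsFiniteMeasure P] (hX : Martingale X 𝓕 P)
    {Q Q' : @Measure Ω (terminal 𝓕)} (hQ : HasDensityProcess 𝓕 P X Q)
    (hQ' : HasDensityProcess 𝓕 P X Q') : Q = Q' := by
  have hfin : Q univ < ⊤ := by
    rw [hQ 0 univ MeasurableSet.univ, Measure.restrict_univ]
    exact (hX.integrable 0).lintegral_lt_top
  have : IsFiniteMeasure Q := ⟨hfin⟩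
  refine @ext_of_generate_finite Ω (terminal 𝓕) Q Q' {A | ∃ t, MeasurableSet[𝓕 t] A}
    ?_ ?_ this ?_ ?_
  · refine le_antisymm (iSup_le fun t A hA => MeasurableSpace.measurableSet_generateFrom ⟨t, hA⟩)
      (MeasurableSpace.generateFrom_le ?_)
    rintro A ⟨t, hA⟩
    exact le_iSup (fun s => 𝓕 s) t A hA
  · rintro A ⟨s, hA⟩ B ⟨t, hB⟩ -
    exact ⟨max s t, (𝓕.mono (le_max_left s t) _ hA).inter (𝓕.mono (le_max_right s t) _ hB)⟩
  · rintro A ⟨t, hA⟩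
    rw [hQ t A hA, hQ' t A hA]
  · rw [hQ 0 univ MeasurableSet.univ, hQ' 0 univ MeasurableSet.univ]

/-! ### Consequences of a density process -/

theorem HasDensityProcess.isProbabilityMeasure [IsProbabilityMeasure P]
    (hQ : HasDensityProcess 𝓕 P X Q) (h1 : ∀ᵐ ω ∂P, X 0 ω = 1) : IsProbabilityMeasure Q := by
  refine ⟨?_⟩
  rw [hQ 0 univ MeasurableSet.univ, Measure.restrict_univ,
    lintegral_congr_ae (g := fun _ => 1) (h1.mono fun ω h => by simp [h])]
  simp

/-- By completeness a `P`-null set already lies in `𝓕 0`, where the density formula applies to it.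
-/
theorem HasDensityProcess.ae_of_ae (hQ : HasDensityProcess 𝓕 P X Q) (hu : UsualConditions 𝓕 P)
    {p : Ω → Prop} (hp : ∀ᵐ ω ∂P, p ω) : ∀ᵐ ω ∂Q, p ω := by
  rw [ae_iff] at hp ⊢
  rw [hQ 0 _ (hu.complete _ hp), setLIntegral_measure_zero _ _ hp]

theorem measurableSet_min_const {τ : Ω → WithTop ℝ≥0} (hτ : IsStoppingTime 𝓕 τ) {t : ℝ≥0}
    {B : Set Ω} (hBt : MeasurableSet[𝓕 t] B) (hBτ : MeasurableSet[hτ.measurableSpace] B) :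
    MeasurableSet[((isStoppingTime_const 𝓕 t).min hτ).measurableSpace] B := by
  refine (IsStoppingTime.measurableSet_min_iff (isStoppingTime_const 𝓕 t) hτ B).2 ⟨?_, hBτ⟩
  rwa [IsStoppingTime.measurableSpace_const]

theorem HasDensityProcess.apply_eq_stoppedProcess [IsFiniteMeasure P] (hX : Martingale X 𝓕 P)
    (h0 : ∀ᵐ ω ∂P, ∀ t, 0 ≤ X t ω)
    (hc : ∀ᵐ ω ∂P, ∀ t, ContinuousWithinAt (fun s => X s ω) (Ioi t) t)
    (hQ : HasDensityProcess 𝓕 P X Q) {τ : Ω → WithTop ℝ≥0} (hτ : IsStoppingTime 𝓕 τ) {t : ℝ≥0}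
    {B : Set Ω} (hB : MeasurableSet[((isStoppingTime_const 𝓕 t).min hτ).measurableSpace] B) :
    Q B = ∫⁻ ω in B, ENNReal.ofReal (stoppedProcess X τ t ω) ∂P := by
  have hle : ∀ ω, min (t : WithTop ℝ≥0) (τ ω) ≤ t := fun ω => min_le_left _ _
  rw [stoppedProcess_eq_stoppedValue, setLIntegral_stoppedValue hX h0 hc _ hle hB]
  exact hQ t B (IsStoppingTime.measurableSpace_le_of_le_const _ hle _ hB)

theorem HasDensityProcess.setLIntegral_inv_stoppedProcess [IsFiniteMeasure P]
    (hu : UsualConditions 𝓕 P) (hX : Martingale X 𝓕 P) (h0 : ∀ᵐ ω ∂P, ∀ t, 0 ≤ X t ω)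
    (hc : ∀ᵐ ω ∂P, ∀ t, ContinuousWithinAt (fun s => X s ω) (Ioi t) t)
    (hQ : HasDensityProcess 𝓕 P X Q) {τ : Ω → WithTop ℝ≥0} (hτ : IsStoppingTime 𝓕 τ) {t : ℝ≥0}
    {B : Set Ω} (hBt : MeasurableSet[𝓕 t] B) (hBτ : MeasurableSet[hτ.measurableSpace] B) :
    ∫⁻ ω in B, ENNReal.ofReal (stoppedProcess X τ t ω)⁻¹ ∂Q
      = P (B ∩ {ω | 0 < stoppedProcess X τ t ω}) :=
  setLIntegral_inv_density (IsStoppingTime.measurableSpace_le' _) (terminal_le 𝓕)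
    (hu.measurable_stoppedValue hX.stronglyAdapted hc ((isStoppingTime_const 𝓕 t).min hτ))
    (fun _ hB => hQ.apply_eq_stoppedProcess hX h0 hc hτ hB) (measurableSet_min_const hτ hBt hBτ)

theorem HasDensityProcess.setLIntegral_inv (hQ : HasDensityProcess 𝓕 P X Q)
    (hX : StronglyAdapted 𝓕 X) {t : ℝ≥0} {A : Set Ω} (hA : MeasurableSet[𝓕 t] A) :
    ∫⁻ ω in A, ENNReal.ofReal (X t ω)⁻¹ ∂Q = P (A ∩ {ω | 0 < X t ω}) :=
  setLIntegral_inv_density (le_iSup (fun s => 𝓕 s) t) (terminal_le 𝓕) (hX t).measurable (hQ t) hA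

end Density

/-! ### Path properties of the hitting times -/

section Paths

variable {Ω : Type*} {X : ℝ≥0 → Ω → ℝ} {ω : Ω}

theorem hitBelow_lt_iff {n : ℕ} {t : ℝ≥0} :
    hitBelow X n ω < t ↔ ∃ s < t, X s ω < 1 / ((n : ℝ) + 1) := by
  rw [hitBelow, hittingAfter_lt_iff]
  simp

theorem le_of_lt_hitBelow {n : ℕ} {t : ℝ≥0} (h : (t : WithTop ℝ≥0) < hitBelow X n ω) :
    1 / ((n : ℝ) + 1) ≤ X t ω := by
  by_contra! hlt
  exact h.not_ge (hittingAfter_le_of_mem (zero_le (a := t)) hlt)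

theorem hitBelow_le_hitLimit (n : ℕ) : hitBelow X n ω ≤ hitLimit X ω :=
  le_ciSup (f := fun n => hitBelow X n ω) ⟨⊤, fun _ _ => le_top⟩ n

theorem hitLimit_le_iff {t : ℝ≥0} :
    hitLimit X ω ≤ t ↔ ∀ n, hitBelow X n ω ≤ t :=
  ciSup_le_iff ⟨⊤, fun _ _ => le_top⟩

theorem monotone_hitBelow : Monotone fun n => hitBelow X n ω := fun _ _ hab =>
  hittingAfter_anti X 0 (Iio_subset_Iio (Nat.one_div_le_one_div hab)) ω

theorem hitLimit_le_of_nonpos {t : ℝ≥0} (h : X t ω ≤ 0) : hitLimit X ω ≤ t :=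
  hitLimit_le_iff.2 fun n => hittingAfter_le_of_mem (zero_le (a := t)) (h.trans_lt (by positivity))

theorem apply_hitBelow_le (hc : ∀ t, ContinuousWithinAt (fun s => X s ω) (Ioi t) t) {n : ℕ}
    {u : ℝ≥0} (hu : hitBelow X n ω = u) : X u ω ≤ 1 / ((n : ℝ) + 1) := by
  by_contra! hlt
  have h : ∀ᶠ s in 𝓝[≥] u, 1 / ((n : ℝ) + 1) < X s ω :=
    (continuousWithinAt_Ioi_iff_Ici.1 (hc u)).eventually (lt_mem_nhds hlt)
  obtain ⟨v, huv, hv⟩ := mem_nhdsGE_iff_exists_Ico_subset.1 h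
  have : hitBelow X n ω < v := by rw [hu]; exact WithTop.coe_lt_coe.2 huv
  obtain ⟨s, hsv, hs⟩ := hitBelow_lt_iff.1 this
  rcases lt_or_ge s u with hsu | hus
  · exact (hitBelow_lt_iff.2 ⟨s, hsu, hs⟩).ne hu
  · exact (hv ⟨hus, hsv⟩).not_gt hs

theorem stoppedProcess_hitBelow_le
    (hc : ∀ t, ContinuousWithinAt (fun s => X s ω) (Ioi t) t) {n : ℕ} {t : ℝ≥0}
    (h : hitBelow X n ω ≤ t) : stoppedProcess X (hitBelow X n) t ω ≤ 1 / ((n : ℝ) + 1) := by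
  obtain ⟨u, hu⟩ := WithTop.ne_top_iff_exists.1 (h.trans_lt (WithTop.coe_lt_top t)).ne
  rw [stoppedProcess_eq_of_ge h, ← hu, untopA_coe]
  exact apply_hitBelow_le hc hu.symm

/-- Up to a hitting time of a positive level, a path that does not jump to zero is positive. -/
theorem stoppedProcess_hitBelow_pos (h0 : ∀ t, 0 ≤ X t ω) (hc : IsCadlag fun t => X t ω)
    (hj : ∀ t : ℝ≥0, hitLimit X ω = t → Function.leftLim (fun s => X s ω) t = 0)
    {n : ℕ} {t : ℝ≥0} (hn : 0 < hitBelow X n ω) : 0 < stoppedProcess X (hitBelow X n) t ω := by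
  rcases lt_or_ge (t : WithTop ℝ≥0) (hitBelow X n ω) with h | h
  · rw [stoppedProcess_eq_of_le h.le]
    exact lt_of_lt_of_le (by positivity) (le_of_lt_hitBelow h)
  obtain ⟨u, hu⟩ := WithTop.ne_top_iff_exists.1 (h.trans_lt (WithTop.coe_lt_top t)).ne
  rw [stoppedProcess_eq_of_ge h, ← hu, untopA_coe]
  -- A zero of `X` at `u = τₙ` forces `τ = u`. Before `u` the path is at least `1/(n+1)`, so its
  -- left limit cannot be zero. Positivity of `u` makes this a genuine left limit.
  refine (h0 u).lt_of_ne fun hXu => ?_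
  have hlim : hitLimit X ω = u :=
    le_antisymm (hitLimit_le_of_nonpos hXu.ge) (hu ▸ hitBelow_le_hitLimit n)
  have hu0 : 0 < u := by rw [← hu] at hn; exact WithTop.coe_lt_coe.1 hn
  have : (𝓝[<] u).NeBot := nhdsLT_neBot_of_exists_lt ⟨0, hu0⟩
  obtain ⟨l, hl⟩ := (hc u).2
  have hl0 : l = 0 := (leftLim_eq_of_tendsto hl).symm.trans (hj u hlim)
  have : 1 / ((n : ℝ) + 1) ≤ l := ge_of_tendsto hl <| by
    filter_upwards [self_mem_nhdsWithin] with s hs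
    exact le_of_lt_hitBelow (by rw [← hu]; exact WithTop.coe_lt_coe.2 hs)
  have : 0 < 1 / ((n : ℝ) + 1) := by positivity
  linarith

theorem leftLim_eq_zero_of_hitBelow_lt (h0 : ∀ t, 0 ≤ X t ω) (hc : IsCadlag fun t => X t ω)
    {t : ℝ≥0} (ht : hitLimit X ω = t) (hlt : ∀ n, hitBelow X n ω < t) :
    Function.leftLim (fun s => X s ω) t = 0 := by
  choose u hu using fun n => WithTop.ne_top_iff_exists.1 ((hlt n).trans (WithTop.coe_lt_top t)).ne
  have hut n : u n < t := by have := hlt n; rw [← hu] at this; exact WithTop.coe_lt_coe.1 this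
  have : (𝓝[<] t).NeBot := nhdsLT_neBot_of_exists_lt ⟨u 0, hut 0⟩
  obtain ⟨l, hl⟩ := (hc t).2
  rw [leftLim_eq_of_tendsto hl]
  have hconv : Tendsto u atTop (𝓝 t) := by
    have h := tendsto_hitBelow X ω
    rw [ht] at h
    refine tendsto_order.2 ⟨fun a ha => ?_, fun a ha => Eventually.of_forall fun n =>
      (hut n).trans ha⟩
    filter_upwards [h.eventually (lt_mem_nhds (WithTop.coe_lt_coe.2 ha))] with n hn
    rw [← hu] at hn
    exact WithTop.coe_lt_coe.1 hn
  have hXu : Tendsto (fun n => X (u n) ω) atTop (𝓝 l) :=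
    hl.comp (tendsto_nhdsWithin_iff.2 ⟨hconv, Eventually.of_forall hut⟩)
  refine le_antisymm (le_of_tendsto_of_tendsto' hXu
    (tendsto_one_div_add_atTop_nhds_zero_nat (𝕜 := ℝ)) fun n =>
      apply_hitBelow_le (fun t => (hc t).1) (hu n).symm) (ge_of_tendsto' hXu fun n => h0 _)

theorem isCadlag_inv (hc : IsCadlag fun t => X t ω) (hτ : hitLimit X ω = ⊤) :
    IsCadlag fun t => (X t ω)⁻¹ := by
  intro t
  have hpos : 0 < X t ω := by
    by_contra! h
    have := hitLimit_le_of_nonpos h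
    rw [hτ] at this
    exact this.not_gt (WithTop.coe_lt_top t)
  refine ⟨(hc t).1.inv₀ hpos.ne', ?_⟩
  rcases eq_or_neBot (𝓝[<] t) with h | h
  · exact ⟨0, by simp [h]⟩
  obtain ⟨l, hl⟩ := (hc t).2
  refine ⟨l⁻¹, hl.inv₀ ?_⟩
  -- Some `τₙ` exceeds `t`, which bounds the path below up to `t` and keeps its left limit away from
  -- zero.
  have : ∃ n, (t : WithTop ℝ≥0) < hitBelow X n ω := by
    by_contra! hle
    have := hitLimit_le_iff.2 hle
    rw [hτ] at this
    exact this.not_gt (WithTop.coe_lt_top t)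
  obtain ⟨n, hn⟩ := this
  have : 1 / ((n : ℝ) + 1) ≤ l := ge_of_tendsto hl <| by
    filter_upwards [self_mem_nhdsWithin] with s hs
    exact le_of_lt_hitBelow ((WithTop.coe_lt_coe.2 hs).trans hn)
  exact (lt_of_lt_of_le (by positivity) this).ne'

end Paths

/-! ### The limit time under both measures, the Föllmer pair and the true martingale property -/

variable {Ω : Type*} {m : MeasurableSpace Ω} {𝓕 : Filtration ℝ≥0 m} {P : Measure Ω}
  {X : ℝ≥0 → Ω → ℝ} {Q : @Measure Ω (terminal 𝓕)}

/-- Off a null set, right-continuous paths reduce `{τₙ < t}` to a countable union over a dense set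
of times. Right-continuity of the filtration makes events with strict inequality sufficient. -/
theorem isStoppingTime_hitBelow (hu : UsualConditions 𝓕 P) (hX : StronglyAdapted 𝓕 X)
    (hc : ∀ᵐ ω ∂P, ∀ t, ContinuousWithinAt (fun s => X s ω) (Ioi t) t) (n : ℕ) :
    IsStoppingTime 𝓕 (hitBelow X n) := by
  have := hu.rightContinuous
  refine isStoppingTime_of_measurableSet_lt_of_isRightContinuous fun t => ?_
  obtain ⟨D, hDc, hDd⟩ := TopologicalSpace.exists_countable_dense ℝ≥0
  have hmeas : MeasurableSet[𝓕 t]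
      (⋃ s ∈ D ∩ Iio t, {ω | X s ω < 1 / ((n : ℝ) + 1)}) := by
    refine MeasurableSet.biUnion (hDc.mono inter_subset_left) fun s hs => ?_
    exact ((hX s).mono (𝓕.mono hs.2.le)).measurable measurableSet_Iio
  refine hu.measurableSet_congr (𝓕.mono bot_le) ?_ hmeas
  filter_upwards [hc] with ω hω
  refine propext ?_
  change ω ∈ (⋃ s ∈ D ∩ Iio t, {ω | X s ω < 1 / ((n : ℝ) + 1)}) ↔ hitBelow X n ω < t
  rw [hitBelow_lt_iff]
  simp only [mem_iUnion, mem_ofPred_eq, exists_prop]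
  constructor
  · rintro ⟨s, hs, h⟩
    exact ⟨s, hs.2, h⟩
  · rintro ⟨s, hst, h⟩
    have h1 : ∀ᶠ r in 𝓝[≥] s, X r ω < 1 / ((n : ℝ) + 1) :=
      (continuousWithinAt_Ioi_iff_Ici.1 (hω s)).eventually (gt_mem_nhds h)
    obtain ⟨v, hsv, hv⟩ := mem_nhdsGE_iff_exists_Ico_subset.1 h1
    obtain ⟨d, hd, hsd, hdv⟩ := hDd.exists_between (lt_min hst hsv)
    exact ⟨d, ⟨hd, hdv.trans_le (min_le_left _ _)⟩, hv ⟨hsd.le, hdv.trans_le (min_le_right _ _)⟩⟩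

theorem isStoppingTime_hitLimit (h : ∀ n, IsStoppingTime 𝓕 (hitBelow X n)) :
    IsStoppingTime 𝓕 (hitLimit X) := by
  intro t
  simp only [hitLimit_le_iff, ofPred_forall]
  exact MeasurableSet.iInter fun n => h n t

theorem HasDensityProcess.apply_hitLimit_le [IsProbabilityMeasure P] (hu : UsualConditions 𝓕 P)
    (hX : Martingale X 𝓕 P) (h0 : ∀ᵐ ω ∂P, ∀ t, 0 ≤ X t ω)
    (hc : ∀ᵐ ω ∂P, ∀ t, ContinuousWithinAt (fun s => X s ω) (Ioi t) t)
    (hQ : HasDensityProcess 𝓕 P X Q) (t : ℝ≥0) : Q {ω | hitLimit X ω ≤ t} = 0 := by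
  have hst := isStoppingTime_hitBelow hu hX.stronglyAdapted hc
  have hle (n : ℕ) : Q {ω | hitLimit X ω ≤ t} ≤ ENNReal.ofReal (1 / ((n : ℝ) + 1)) := by
    have hBt := hst n t
    have hB := measurableSet_min_const (hst n) hBt ((hst n).measurableSet_le' t)
    calc Q {ω | hitLimit X ω ≤ t} ≤ Q {ω | hitBelow X n ω ≤ t} :=
          measure_mono fun ω h => (hitBelow_le_hitLimit n).trans h
      _ = ∫⁻ ω in {ω | hitBelow X n ω ≤ t},
            ENNReal.ofReal (stoppedProcess X (hitBelow X n) t ω) ∂P :=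
          hQ.apply_eq_stoppedProcess hX h0 hc (hst n) hB
      _ ≤ ∫⁻ _ in {ω | hitBelow X n ω ≤ t}, ENNReal.ofReal (1 / ((n : ℝ) + 1)) ∂P := by
          refine lintegral_mono_ae ((ae_restrict_iff' (𝓕.le t _ hBt)).2 ?_)
          filter_upwards [hc] with ω hω h
          exact ENNReal.ofReal_le_ofReal (stoppedProcess_hitBelow_le hω h)
      _ ≤ ENNReal.ofReal (1 / ((n : ℝ) + 1)) := by
          rw [setLIntegral_const]
          exact mul_le_of_le_one_right' prob_le_one
  have hlim : Tendsto (fun n : ℕ => ENNReal.ofReal (1 / ((n : ℝ) + 1))) atTop (𝓝 0) := by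
    simpa using ENNReal.tendsto_ofReal (tendsto_one_div_add_atTop_nhds_zero_nat (𝕜 := ℝ))
  exact le_antisymm (ge_of_tendsto' hlim hle) bot_le

theorem HasDensityProcess.ae_hitLimit_eq_top [IsProbabilityMeasure P] (hu : UsualConditions 𝓕 P)
    (hX : Martingale X 𝓕 P) (h0 : ∀ᵐ ω ∂P, ∀ t, 0 ≤ X t ω)
    (hc : ∀ᵐ ω ∂P, ∀ t, ContinuousWithinAt (fun s => X s ω) (Ioi t) t)
    (hQ : HasDensityProcess 𝓕 P X Q) : ∀ᵐ ω ∂Q, hitLimit X ω = ⊤ := by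
  have h : ∀ᵐ ω ∂Q, ∀ n : ℕ, ¬ hitLimit X ω ≤ ((n : ℝ≥0) : WithTop ℝ≥0) := ae_all_iff.2 fun n => by
    rw [ae_iff]
    simpa using hQ.apply_hitLimit_le hu hX h0 hc n
  filter_upwards [h] with ω hω
  by_contra hne
  obtain ⟨u, hu⟩ := WithTop.ne_top_iff_exists.1 hne
  obtain ⟨n, hn⟩ := exists_nat_ge u
  exact hω n (hu ▸ WithTop.coe_le_coe.2 hn)

/-- The martingale stays at zero after the limit of the hitting times. -/
theorem HasDensityProcess.ae_eq_zero_of_hitLimit_le [IsProbabilityMeasure P]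
    (hu : UsualConditions 𝓕 P) (hX : Martingale X 𝓕 P) (h0 : ∀ᵐ ω ∂P, ∀ t, 0 ≤ X t ω)
    (hc : ∀ᵐ ω ∂P, ∀ t, ContinuousWithinAt (fun s => X s ω) (Ioi t) t)
    (hQ : HasDensityProcess 𝓕 P X Q) :
    ∀ᵐ ω ∂P, ∀ t : ℝ≥0, hitLimit X ω ≤ t → X t ω = 0 := by
  have hst := isStoppingTime_hitLimit (isStoppingTime_hitBelow hu hX.stronglyAdapted hc)
  obtain ⟨D, hDc, hDd⟩ := TopologicalSpace.exists_countable_dense ℝ≥0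
  have h : ∀ᵐ ω ∂P, ∀ s ∈ D, hitLimit X ω ≤ s → X s ω = 0 := (ae_ball_iff hDc).2 fun s _ => by
    -- The vanishing of `Q(τ ≤ s)` is the vanishing of the `P`-integral of `X s` over this event.
    have hz := hQ.apply_hitLimit_le hu hX h0 hc s
    rw [hQ s _ (hst s), setLIntegral_eq_zero_iff (𝓕.le s _ (hst s))
      ((hX.stronglyAdapted s).mono (𝓕.le s)).measurable.ennreal_ofReal] at hz
    filter_upwards [hz, h0] with ω hω h0 hle
    exact le_antisymm (ENNReal.ofReal_eq_zero.1 (hω hle)) (h0 s)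
  filter_upwards [h, hc] with ω hω hc t ht
  -- A nonzero value at `t` would persist on an interval to the right of `t`, which contains a point
  -- of `D`.
  by_contra hne
  have h1 : ∀ᶠ r in 𝓝[≥] t, X r ω ≠ 0 :=
    (continuousWithinAt_Ioi_iff_Ici.1 (hc t)).eventually_ne hne
  obtain ⟨v, htv, hv⟩ := mem_nhdsGE_iff_exists_Ico_subset.1 h1
  obtain ⟨d, hd, htd, hdv⟩ := hDd.exists_between htv
  exact hv ⟨htd.le, hdv⟩ (hω d hd (ht.trans (WithTop.coe_le_coe.2 htd.le)))

theorem HasDensityProcess.measure_inter_lt_hitLimit [IsProbabilityMeasure P]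
    (hu : UsualConditions 𝓕 P) (hX : Martingale X 𝓕 P) (h0 : ∀ᵐ ω ∂P, ∀ t, 0 ≤ X t ω)
    (hc : ∀ᵐ ω ∂P, ∀ t, ContinuousWithinAt (fun s => X s ω) (Ioi t) t)
    (hQ : HasDensityProcess 𝓕 P X Q) {t : ℝ≥0} {A : Set Ω} (hA : MeasurableSet[𝓕 t] A) :
    P (A ∩ {ω | (t : WithTop ℝ≥0) < hitLimit X ω}) = ∫⁻ ω in A, ENNReal.ofReal (X t ω)⁻¹ ∂Q := by
  rw [hQ.setLIntegral_inv hX.stronglyAdapted hA]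
  refine measure_congr ?_
  filter_upwards [hQ.ae_eq_zero_of_hitLimit_le hu hX h0 hc, h0] with ω h1 h2
  refine propext (and_congr_right fun _ => ?_)
  change (t : WithTop ℝ≥0) < hitLimit X ω ↔ 0 < X t ω
  refine ⟨fun h => ?_, fun h => ?_⟩
  · by_contra! h'
    exact (hitLimit_le_of_nonpos h').not_gt h
  · by_contra! h'
    exact h.ne' (h1 t h')

theorem HasDensityProcess.lintegral_inv_ne_top [IsFiniteMeasure P]
    (hQ : HasDensityProcess 𝓕 P X Q) (hX : StronglyAdapted 𝓕 X) (t : ℝ≥0) :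
    ∫⁻ ω, ENNReal.ofReal (X t ω)⁻¹ ∂Q ≠ ⊤ := by
  rw [← setLIntegral_univ, hQ.setLIntegral_inv hX MeasurableSet.univ]
  exact measure_ne_top _ _

theorem stronglyAdapted_inv (hX : StronglyAdapted 𝓕 X) :
    StronglyAdapted (onTerminal 𝓕) fun t ω => (X t ω)⁻¹ := fun t =>
  (@Measurable.inv ℝ Ω _ _ _ (𝓕 t) _ (hX t).measurable).stronglyMeasurable

theorem HasDensityProcess.isFoellmerPair [IsProbabilityMeasure P] (hu : UsualConditions 𝓕 P)
    (hX : Martingale X 𝓕 P) (h0 : ∀ᵐ ω ∂P, ∀ t, 0 ≤ X t ω)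
    (hc : ∀ᵐ ω ∂P, IsCadlag fun t => X t ω) (h1 : ∀ᵐ ω ∂P, X 0 ω = 1)
    (hQ : HasDensityProcess 𝓕 P X Q) :
    IsFoellmerPair (onTerminal 𝓕) Q (fun t ω => (X t ω)⁻¹) (P.trim (terminal_le 𝓕))
      (hitLimit X) := by
  have hc' : ∀ᵐ ω ∂P, ∀ t, ContinuousWithinAt (fun s => X s ω) (Ioi t) t :=
    hc.mono fun ω h t => (h t).1
  have hQp := hQ.isProbabilityMeasure h1
  have hst := isStoppingTime_hitLimit (isStoppingTime_hitBelow hu hX.stronglyAdapted hc')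
  have hpos : ∀ᵐ ω ∂Q, ∀ t, 0 ≤ (X t ω)⁻¹ :=
    (hQ.ae_of_ae hu h0).mono fun ω h t => inv_nonneg.2 (h t)
  have htop := hQ.ae_hitLimit_eq_top hu hX h0 hc'
  have heq (t : ℝ≥0) (A : Set Ω) (hA : MeasurableSet[𝓕 t] A) :=
    hQ.measure_inter_lt_hitLimit hu hX h0 hc' hA
  refine ⟨hQp, ⟨?_⟩, ?_, hpos, ?_, ?_, fun t => hst t, htop, ?_⟩
  · rw [trim_measurableSet_eq _ MeasurableSet.univ, measure_univ]
  · refine supermartingale_of_setLIntegral_le (stronglyAdapted_inv hX.stronglyAdapted)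
      (fun t => hpos.mono fun ω h => h t) (hQ.lintegral_inv_ne_top hX.stronglyAdapted)
      fun s t hst A hA => ?_
    rw [← heq s A hA, ← heq t A (𝓕.mono hst _ hA)]
    exact measure_mono fun ω h => ⟨h.1, (WithTop.coe_le_coe.2 hst).trans_lt h.2⟩
  · filter_upwards [hQ.ae_of_ae hu hc, htop] with ω h h' using isCadlag_inv h h'
  · filter_upwards [hQ.ae_of_ae hu h1] with ω h
    simp [h]
  · intro t A hA
    have hA' : MeasurableSet[terminal 𝓕] (A ∩ {ω | (t : WithTop ℝ≥0) < hitLimit X ω}) :=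
      le_iSup (fun s => 𝓕 s) t _ (MeasurableSet.inter hA (hst.measurableSet_gt t))
    rw [trim_measurableSet_eq _ hA', heq t A hA]

theorem HasDensityProcess.martingale_inv_iff [IsProbabilityMeasure P] (hu : UsualConditions 𝓕 P)
    (hX : Martingale X 𝓕 P) (h0 : ∀ᵐ ω ∂P, ∀ t, 0 ≤ X t ω)
    (hc : ∀ᵐ ω ∂P, ∀ t, ContinuousWithinAt (fun s => X s ω) (Ioi t) t)
    (h1 : ∀ᵐ ω ∂P, X 0 ω = 1) (hQ : HasDensityProcess 𝓕 P X Q) :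
    Martingale (fun t ω => (X t ω)⁻¹) (onTerminal 𝓕) Q ↔ ∀ᵐ ω ∂P, ∀ t, 0 < X t ω := by
  have hQp := hQ.isProbabilityMeasure h1
  have hpos : ∀ t, ∀ᵐ ω ∂Q, 0 ≤ (X t ω)⁻¹ := fun t =>
    (hQ.ae_of_ae hu h0).mono fun ω h => inv_nonneg.2 (h t)
  constructor
  · intro hM
    -- The `Q`-expectation of `1 / X t` is `P(τ > t)`, and it must keep its initial value one.
    have hone (t : ℝ≥0) : P {ω | (t : WithTop ℝ≥0) < hitLimit X ω} = 1 := by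
      have h := lintegral_ofReal_eq_of_martingale hM hpos t
      rw [← setLIntegral_univ, ← hQ.measure_inter_lt_hitLimit hu hX h0 hc MeasurableSet.univ,
        univ_inter] at h
      rw [h, lintegral_congr_ae (g := fun _ => 1)
        ((hQ.ae_of_ae hu h1).mono fun ω h => by simp [h])]
      simp
    have hst := isStoppingTime_hitLimit (isStoppingTime_hitBelow hu hX.stronglyAdapted hc)
    have hall : ∀ᵐ ω ∂P, ∀ n : ℕ, ((n : ℝ≥0) : WithTop ℝ≥0) < hitLimit X ω :=
      ae_all_iff.2 fun n =>
        (mem_ae_iff_prob_eq_one (𝓕.le n _ (hst.measurableSet_gt n))).2 (hone n)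
    filter_upwards [hall] with ω hω t
    by_contra! h
    obtain ⟨n, hn⟩ := exists_nat_ge t
    exact (hω n).not_ge ((hitLimit_le_of_nonpos h).trans (WithTop.coe_le_coe.2 hn))
  · intro hp
    refine martingale_of_setLIntegral_eq (stronglyAdapted_inv hX.stronglyAdapted) hpos
      (hQ.lintegral_inv_ne_top hX.stronglyAdapted) fun s t hst A hA => ?_
    have h (r : ℝ≥0) (hA : MeasurableSet[𝓕 r] A) :
        ∫⁻ ω in A, ENNReal.ofReal (X r ω)⁻¹ ∂Q = P A := by
      rw [hQ.setLIntegral_inv hX.stronglyAdapted hA]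
      refine measure_congr ?_
      filter_upwards [hp] with ω hω
      exact propext ⟨fun h => h.1, fun h => ⟨h, hω r⟩⟩
    rw [h s hA, h t (𝓕.mono hst _ hA)]

/-! ### The local martingale property -/

/-- `Locally` multiplies by the indicator of `{⊥ < σ}` before stopping. It matters for `hitBelow X
0`: its level is the starting value one, so it can be zero. -/
theorem stoppedProcess_indicator_inv (X : ℝ≥0 → Ω → ℝ) (σ : Ω → WithTop ℝ≥0) (t : ℝ≥0) :
    stoppedProcess (fun i => {ω | ⊥ < σ ω}.indicator fun ω => (X i ω)⁻¹) σ t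
      = {ω | ⊥ < σ ω}.indicator fun ω => (stoppedProcess X σ t ω)⁻¹ := by
  rw [stoppedProcess_indicator_comm]
  rfl

theorem stoppedProcess_zero (X : ℝ≥0 → Ω → ℝ) (σ : Ω → WithTop ℝ≥0) (ω : Ω) :
    stoppedProcess X σ 0 ω = X 0 ω :=
  stoppedProcess_eq_of_le bot_le

theorem measurableSet_inter_lt {σ : Ω → WithTop ℝ≥0} (hσ : IsStoppingTime 𝓕 σ) {s : ℝ≥0}
    {A : Set Ω} (hA : MeasurableSet[𝓕 s] A) :
    MeasurableSet[hσ.measurableSpace] (A ∩ {ω | (s : WithTop ℝ≥0) < σ ω}) := by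
  have hs : MeasurableSet[𝓕 s] (A ∩ {ω | (s : WithTop ℝ≥0) < σ ω}) :=
    MeasurableSet.inter hA (hσ.measurableSet_gt s)
  refine ⟨le_iSup (fun s => 𝓕 s) s _ hs, fun i => ?_⟩
  rcases le_total s i with h | h
  · exact MeasurableSet.inter (𝓕.mono h _ hs) (hσ i)
  · convert! @MeasurableSet.empty Ω (𝓕 i)
    refine eq_empty_of_forall_notMem fun ω hω => ?_
    exact (hω.1.2.trans_le hω.2).not_ge (WithTop.coe_le_coe.2 h)

theorem HasDensityProcess.setLIntegral_stoppedProcess_inv [IsFiniteMeasure P]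
    (hu : UsualConditions 𝓕 P) (hX : Martingale X 𝓕 P) (h0 : ∀ᵐ ω ∂P, ∀ t, 0 ≤ X t ω)
    (hc : ∀ᵐ ω ∂P, ∀ t, ContinuousWithinAt (fun s => X s ω) (Ioi t) t)
    (hQ : HasDensityProcess 𝓕 P X Q) {σ : Ω → WithTop ℝ≥0} (hσ : IsStoppingTime 𝓕 σ) {t : ℝ≥0}
    {B : Set Ω} (hBt : MeasurableSet[𝓕 t] B) (hBσ : MeasurableSet[hσ.measurableSpace] B) :
    ∫⁻ ω in B, ENNReal.ofReal (stoppedProcess (fun i => {ω | ⊥ < σ ω}.indicator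
        fun ω => (X i ω)⁻¹) σ t ω) ∂Q
      = P ({ω | ⊥ < σ ω} ∩ B ∩ {ω | 0 < stoppedProcess X σ t ω}) := by
  have hS : MeasurableSet[𝓕 0] {ω | ⊥ < σ ω} := hσ.measurableSet_gt 0
  rw [← hQ.setLIntegral_inv_stoppedProcess hu hX h0 hc hσ
    (MeasurableSet.inter (𝓕.mono bot_le _ hS) hBt)
    (MeasurableSet.inter (zero_le_measurableSpace hσ _ hS) hBσ),
    ← setLIntegral_indicator (le_iSup (fun s => 𝓕 s) 0 _ hS), stoppedProcess_indicator_inv]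
  refine lintegral_congr fun ω => ?_
  by_cases hω : ω ∈ {ω | ⊥ < σ ω}
  · rw [indicator_of_mem hω, indicator_of_mem hω]
  · rw [indicator_of_notMem hω, indicator_of_notMem hω, ENNReal.ofReal_zero]

/-- Along the hitting times, the reciprocal of a martingale that does not jump to zero is a
martingale under the changed measure. -/
theorem HasDensityProcess.martingale_stoppedProcess_hitBelow [IsProbabilityMeasure P]
    (hu : UsualConditions 𝓕 P) (hX : Martingale X 𝓕 P) (h0 : ∀ᵐ ω ∂P, ∀ t, 0 ≤ X t ω)
    (hc : ∀ᵐ ω ∂P, IsCadlag fun t => X t ω) (h1 : ∀ᵐ ω ∂P, X 0 ω = 1)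
    (hQ : HasDensityProcess 𝓕 P X Q)
    (hj : ∀ᵐ ω ∂P, ∀ t : ℝ≥0, hitLimit X ω = t → Function.leftLim (fun s => X s ω) t = 0)
    (n : ℕ) :
    Martingale (stoppedProcess (fun i => {ω | ⊥ < hitBelow X n ω}.indicator fun ω => (X i ω)⁻¹)
      (hitBelow X n)) (onTerminal 𝓕) Q := by
  have hc' : ∀ᵐ ω ∂P, ∀ t, ContinuousWithinAt (fun s => X s ω) (Ioi t) t :=
    hc.mono fun ω h t => (h t).1
  have hQp := hQ.isProbabilityMeasure h1
  set σ := hitBelow X n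
  have hσ : IsStoppingTime 𝓕 σ := isStoppingTime_hitBelow hu hX.stronglyAdapted hc' n
  have hpos0 : MeasurableSet[𝓕 0] {ω | ⊥ < σ ω} := hσ.measurableSet_gt 0
  have hpos : ∀ᵐ ω ∂P, ⊥ < σ ω → ∀ t, 0 < stoppedProcess X σ t ω := by
    filter_upwards [h0, hc, hj] with ω h0 hc hj h t
    exact stoppedProcess_hitBelow_pos h0 hc hj h
  have hmeas (t : ℝ≥0) : Measurable[𝓕 t] (stoppedProcess X σ t) :=
    (hu.measurable_stoppedValue hX.stronglyAdapted hc' ((isStoppingTime_const 𝓕 t).min hσ)).mono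
      (IsStoppingTime.measurableSpace_le_of_le_const _ fun _ => min_le_left _ _) le_rfl
  have hnn (t : ℝ≥0) : ∀ᵐ ω ∂Q, 0 ≤ stoppedProcess (fun i => {ω | ⊥ < σ ω}.indicator
      fun ω => (X i ω)⁻¹) σ t ω := by
    filter_upwards [hQ.ae_of_ae hu h0] with ω h
    rw [stoppedProcess_indicator_inv]
    exact indicator_apply_nonneg fun _ => inv_nonneg.2 (h _)
  refine martingale_of_setLIntegral_eq (fun t => ?_) hnn (fun t => ?_) fun s t hst A hA => ?_
  · have hpt : MeasurableSet[𝓕 t] {ω | ⊥ < σ ω} := 𝓕.mono bot_le _ hpos0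
    rw [stoppedProcess_indicator_inv]
    exact ((hmeas t).inv.indicator hpt).stronglyMeasurable
  · rw [← setLIntegral_univ, hQ.setLIntegral_stoppedProcess_inv hu hX h0 hc' hσ
      MeasurableSet.univ MeasurableSet.univ]
    exact measure_ne_top _ _
  -- Split `A` along `{s < σ}`: there both integrals equal the `P`-measure of the set, while on `{σ
  -- ≤ s}` the stopped process no longer moves between `s` and `t`.
  · have hS : MeasurableSet[𝓕 s] {ω | (s : WithTop ℝ≥0) < σ ω} := hσ.measurableSet_gt s
    have hB : MeasurableSet[𝓕 s] (A ∩ {ω | (s : WithTop ℝ≥0) < σ ω}) := MeasurableSet.inter hA hS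
    have hBσ := measurableSet_inter_lt hσ hA
    have hval (r : ℝ≥0) (hBr : MeasurableSet[𝓕 r] (A ∩ {ω | (s : WithTop ℝ≥0) < σ ω})) :
        ∫⁻ ω in A ∩ {ω | (s : WithTop ℝ≥0) < σ ω}, ENNReal.ofReal (stoppedProcess (fun i =>
          {ω | ⊥ < σ ω}.indicator fun ω => (X i ω)⁻¹) σ r ω) ∂Q
          = P (A ∩ {ω | (s : WithTop ℝ≥0) < σ ω}) := by
      rw [hQ.setLIntegral_stoppedProcess_inv hu hX h0 hc' hσ hBr hBσ]
      refine measure_congr ?_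
      filter_upwards [hpos] with ω hω
      refine propext ⟨fun h => h.1.2, fun h => ?_⟩
      have hlt : ⊥ < σ ω := lt_of_le_of_lt bot_le h.2
      exact ⟨⟨hlt, h⟩, hω hlt r⟩
    have hST := le_iSup (fun s => 𝓕 s) s _ hS
    have hAT := le_iSup (fun s => 𝓕 s) s _ hA
    rw [← lintegral_inter_add_sdiff _ A hST, ← lintegral_inter_add_sdiff _ A hST,
      hval s hB, hval t (𝓕.mono hst _ hB)]
    congr 1
    refine setLIntegral_congr_fun (hAT.diff hST) fun ω hω => ?_
    have hσs : σ ω ≤ s := not_lt.1 hω.2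
    simp only [stoppedProcess_eq_of_ge hσs,
      stoppedProcess_eq_of_ge (hσs.trans (WithTop.coe_le_coe.2 hst))]

/-- The stopped reciprocal has `Q`-expectation `P(σ > 0, X_{σ∧n} > 0)` at time `n` and `P(σ > 0)` at
time zero. Equality makes `X_{σ∧n}` positive, whereas `X` is zero from `τ` on. -/
theorem HasDensityProcess.ae_lt_hitLimit_of_martingale [IsProbabilityMeasure P]
    (hu : UsualConditions 𝓕 P) (hX : Martingale X 𝓕 P) (h0 : ∀ᵐ ω ∂P, ∀ t, 0 ≤ X t ω)
    (hc : ∀ᵐ ω ∂P, ∀ t, ContinuousWithinAt (fun s => X s ω) (Ioi t) t)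
    (h1 : ∀ᵐ ω ∂P, X 0 ω = 1) (hQ : HasDensityProcess 𝓕 P X Q)
    {σ : Ω → WithTop ℝ≥0} (hσ : IsStoppingTime 𝓕 σ)
    (hM : Martingale (stoppedProcess (fun i => {ω | ⊥ < σ ω}.indicator fun ω => (X i ω)⁻¹) σ)
      (onTerminal 𝓕) Q) :
    ∀ᵐ ω ∂P, hitLimit X ω ≠ ⊤ → σ ω < hitLimit X ω := by
  have hQp := hQ.isProbabilityMeasure h1
  have hS : MeasurableSet[𝓕 0] {ω | ⊥ < σ ω} := hσ.measurableSet_gt 0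
  have hnn (t : ℝ≥0) : ∀ᵐ ω ∂Q, 0 ≤ stoppedProcess (fun i => {ω | ⊥ < σ ω}.indicator
      fun ω => (X i ω)⁻¹) σ t ω := by
    filter_upwards [hQ.ae_of_ae hu h0] with ω h
    rw [stoppedProcess_indicator_inv]
    exact indicator_apply_nonneg fun _ => inv_nonneg.2 (h _)
  have hpos : ∀ᵐ ω ∂P, ∀ n : ℕ, ⊥ < σ ω → 0 < stoppedProcess X σ n ω := by
    refine ae_all_iff.2 fun n => ?_
    have h := lintegral_ofReal_eq_of_martingale hM hnn n
    rw [← setLIntegral_univ, hQ.setLIntegral_stoppedProcess_inv hu hX h0 hc hσ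
      MeasurableSet.univ MeasurableSet.univ, ← setLIntegral_univ (μ := Q),
      hQ.setLIntegral_stoppedProcess_inv hu hX h0 hc hσ MeasurableSet.univ MeasurableSet.univ,
      inter_univ] at h
    have h' : P ({ω | ⊥ < σ ω} ∩ {ω | 0 < stoppedProcess X σ 0 ω}) = P {ω | ⊥ < σ ω} := by
      refine measure_congr ?_
      filter_upwards [h1] with ω hω
      refine propext ⟨fun h => h.1, fun h => ⟨h, ?_⟩⟩
      change 0 < stoppedProcess X σ 0 ω
      rw [stoppedProcess_zero, hω]
      exact one_pos
    have hmeas : Measurable (stoppedProcess X σ n) :=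
      (hu.measurable_stoppedValue hX.stronglyAdapted hc ((isStoppingTime_const 𝓕 n).min hσ)).mono
        (IsStoppingTime.measurableSpace_le _) le_rfl
    have hae := ae_eq_of_subset_of_measure_ge inter_subset_left (h.trans h').ge
      ((𝓕.le 0 _ hS).inter (measurableSet_lt measurable_const hmeas)).nullMeasurableSet
      (measure_ne_top _ _)
    filter_upwards [hae.mem_iff] with ω hω h
    exact (hω.2 h).2
  filter_upwards [hpos, hQ.ae_eq_zero_of_hitLimit_le hu hX h0 hc, h1] with ω hω hz h1 hne
  obtain ⟨u, hu⟩ := WithTop.ne_top_iff_exists.1 hne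
  rcases eq_or_ne (σ ω) ⊥ with hbot | hbot
  · rw [hbot, bot_lt_iff_ne_bot]
    intro h
    have := hz 0 h.le
    rw [h1] at this
    exact one_ne_zero this
  obtain ⟨n, hn⟩ := exists_nat_ge u
  by_contra! hle
  have hp := hω n (bot_lt_iff_ne_bot.2 hbot)
  rw [stoppedProcess] at hp
  refine hp.ne' (hz _ ?_)
  have hmin : min ((n : ℝ≥0) : WithTop ℝ≥0) (σ ω) ≠ ⊤ :=
    ((min_le_left _ _).trans_lt (WithTop.coe_lt_top _)).ne
  obtain ⟨v, hv⟩ := WithTop.ne_top_iff_exists.1 hmin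
  rw [← hv, untopA_coe, hv]
  exact le_min (hu ▸ WithTop.coe_le_coe.2 hn) hle

theorem tendsto_measure_lt_zero {Ω : Type*} {_ : MeasurableSpace Ω} {μ : Measure Ω}
    [IsFiniteMeasure μ] {σ : ℕ → Ω → WithTop ℝ≥0}
    (htop : ∀ᵐ ω ∂μ, Tendsto (fun k => σ k ω) atTop (𝓝 ⊤)) {t : ℝ≥0}
    (hσ : ∀ k, MeasurableSet {ω | σ k ω < t}) :
    Tendsto (fun k => μ {ω | σ k ω < t}) atTop (𝓝 0) := by
  rw [← measure_empty (μ := μ)]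
  refine tendsto_measure_of_ae_tendsto_indicator_of_isFiniteMeasure atTop
    MeasurableSet.empty hσ ?_
  filter_upwards [htop] with ω hω
  filter_upwards [hω.eventually (lt_mem_nhds (WithTop.coe_lt_top t))] with k hk
  exact iff_of_false hk.not_gt (notMem_empty _)

/-- If stopping times announce the limit of the hitting times and increase to infinity under the
changed measure, then the hitting times stay strictly below their limit. -/
theorem HasDensityProcess.ae_hitBelow_lt_hitLimit [IsProbabilityMeasure P]
    (hu : UsualConditions 𝓕 P) (hX : Martingale X 𝓕 P) (h0 : ∀ᵐ ω ∂P, ∀ t, 0 ≤ X t ω)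
    (hc : ∀ᵐ ω ∂P, ∀ t, ContinuousWithinAt (fun s => X s ω) (Ioi t) t)
    (h1 : ∀ᵐ ω ∂P, X 0 ω = 1) (hQ : HasDensityProcess 𝓕 P X Q)
    {σ : ℕ → Ω → WithTop ℝ≥0} (hσ : ∀ k, IsStoppingTime 𝓕 (σ k))
    (htop : ∀ᵐ ω ∂Q, Tendsto (fun k => σ k ω) atTop (𝓝 ⊤))
    (hlt : ∀ᵐ ω ∂P, ∀ k, hitLimit X ω ≠ ⊤ → σ k ω < hitLimit X ω) :
    ∀ᵐ ω ∂P, ∀ n, hitLimit X ω ≠ ⊤ → hitBelow X n ω < hitLimit X ω := by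
  have hQp := hQ.isProbabilityMeasure h1
  have hmain (n N : ℕ) :
      P {ω | hitLimit X ω ≤ hitBelow X n ω ∧ hitLimit X ω < (N : ℝ≥0)} = 0 := by
    have hτn := isStoppingTime_hitBelow hu hX.stronglyAdapted hc
    have hτ := isStoppingTime_hitLimit hτn
    have hL : MeasurableSet {ω | hitLimit X ω ≤ hitBelow X n ω ∧ hitLimit X ω < (N : ℝ≥0)} :=
      (measurableSet_le hτ.measurable' (hτn n).measurable').inter
        (𝓕.le N _ (hτ.measurableSet_lt N))
    have hst (k : ℕ) : MeasurableSet[𝓕 N] {ω | σ k ω < (N : ℝ≥0)} := (hσ k).measurableSet_lt N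
    have hlim : Tendsto (fun k => Q {ω | σ k ω < (N : ℝ≥0)}) atTop (𝓝 0) :=
      tendsto_measure_lt_zero htop fun k => le_iSup (fun s => 𝓕 s) (N : ℝ≥0) _ (hst k)
    -- On the event, `σ k < τ ≤ τₙ` and `σ k < N`, so `X` is at least `1/(n+1)` at `σ k`, and the
    -- event is `P`-a.s. contained in `{σ k < N}`, whose `Q`-measure is the `P`-integral of the
    -- stopped process.
    have hle (k : ℕ) : ENNReal.ofReal (1 / ((n : ℝ) + 1)) *
        P {ω | hitLimit X ω ≤ hitBelow X n ω ∧ hitLimit X ω < (N : ℝ≥0)}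
        ≤ Q {ω | σ k ω < (N : ℝ≥0)} := by
      have hB := measurableSet_min_const (hσ k) (hst k) ((hσ k).measurableSet_lt' N)
      rw [hQ.apply_eq_stoppedProcess hX h0 hc (hσ k) hB]
      calc _ = ∫⁻ _ in {ω | hitLimit X ω ≤ hitBelow X n ω ∧ hitLimit X ω < (N : ℝ≥0)},
            ENNReal.ofReal (1 / ((n : ℝ) + 1)) ∂P := (setLIntegral_const _ _).symm
        _ ≤ ∫⁻ ω in {ω | hitLimit X ω ≤ hitBelow X n ω ∧ hitLimit X ω < (N : ℝ≥0)},
            ENNReal.ofReal (stoppedProcess X (σ k) N ω) ∂P := by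
          refine lintegral_mono_ae ((ae_restrict_iff' hL).2 ?_)
          filter_upwards [hlt] with ω hω h
          have hσL := hω k (h.2.trans (WithTop.coe_lt_top _)).ne
          obtain ⟨v, hv⟩ := WithTop.ne_top_iff_exists.1 (hσL.trans_le le_top).ne
          rw [stoppedProcess_eq_of_ge (hσL.trans h.2).le, ← hv, untopA_coe]
          exact ENNReal.ofReal_le_ofReal (le_of_lt_hitBelow (hv ▸ hσL.trans_le h.1))
        _ ≤ _ := by
          refine lintegral_mono_set' ?_
          filter_upwards [hlt] with ω hω h
          exact (hω k (h.2.trans (WithTop.coe_lt_top _)).ne).trans h.2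
    have := le_of_tendsto_of_tendsto' tendsto_const_nhds hlim hle
    have hpos : ENNReal.ofReal (1 / ((n : ℝ) + 1)) ≠ 0 := by
      rw [Ne, ENNReal.ofReal_eq_zero, not_le]
      positivity
    exact (mul_eq_zero.1 (le_antisymm this bot_le)).resolve_left hpos
  have hall : ∀ᵐ ω ∂P, ∀ n N : ℕ, ¬ (hitLimit X ω ≤ hitBelow X n ω ∧ hitLimit X ω < (N : ℝ≥0)) :=
    ae_all_iff.2 fun n => ae_all_iff.2 fun N => by
      rw [ae_iff]
      simpa only [not_not] using hmain n N
  filter_upwards [hall] with ω hω n hne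
  by_contra! hle
  obtain ⟨u, hu⟩ := WithTop.ne_top_iff_exists.1 hne
  obtain ⟨N, hN⟩ := exists_nat_gt u
  exact hω n N ⟨hle, hu ▸ WithTop.coe_lt_coe.2 hN⟩

theorem HasDensityProcess.isLocalMartingale_inv_iff [IsProbabilityMeasure P]
    (hu : UsualConditions 𝓕 P) (hX : Martingale X 𝓕 P) (h0 : ∀ᵐ ω ∂P, ∀ t, 0 ≤ X t ω)
    (hc : ∀ᵐ ω ∂P, IsCadlag fun t => X t ω) (h1 : ∀ᵐ ω ∂P, X 0 ω = 1)
    (hQ : HasDensityProcess 𝓕 P X Q) :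
    IsLocalMartingale (fun t ω => (X t ω)⁻¹) (onTerminal 𝓕) Q ↔
      ∀ᵐ ω ∂P, ∀ t : ℝ≥0, hitLimit X ω = t → Function.leftLim (fun s => X s ω) t = 0 := by
  have hc' : ∀ᵐ ω ∂P, ∀ t, ContinuousWithinAt (fun s => X s ω) (Ioi t) t :=
    hc.mono fun ω h t => (h t).1
  constructor
  · rintro ⟨σ, hσ, hM⟩
    have hσs (k : ℕ) : IsStoppingTime 𝓕 (σ k) := fun t => hσ.isStoppingTime k t
    have hlt := ae_all_iff.2 fun k =>
      hQ.ae_lt_hitLimit_of_martingale hu hX h0 hc' h1 (hσs k) (hM k)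
    filter_upwards [hQ.ae_hitBelow_lt_hitLimit hu hX h0 hc' h1 hσs hσ.tendsto_top hlt, h0, hc]
      with ω hω h0 hc t ht
    refine leftLim_eq_zero_of_hitBelow_lt h0 hc ht fun n => ?_
    have := hω n (by rw [ht]; exact WithTop.coe_ne_top)
    rwa [ht] at this
  · intro hj
    refine ⟨hitBelow X, ⟨⟨fun n t => isStoppingTime_hitBelow hu hX.stronglyAdapted hc' n t, ?_⟩,
      ae_of_all _ fun ω => monotone_hitBelow⟩,
      hQ.martingale_stoppedProcess_hitBelow hu hX h0 hc h1 hj⟩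
    filter_upwards [hQ.ae_hitLimit_eq_top hu hX h0 hc'] with ω hω
    simpa only [hω] using tendsto_hitBelow X ω

end FoellmerPair

theorem mainTheorem1 {Ω : Type*} {m : MeasurableSpace Ω} (𝓕 : Filtration ℝ≥0 m)
    (Qcheck : Measure Ω) [IsProbabilityMeasure Qcheck]
    (husual : FoellmerPair.UsualConditions 𝓕 Qcheck)
    (Zcheck : ℝ≥0 → Ω → ℝ)
    (hmart : Martingale Zcheck 𝓕 Qcheck)
    (hui : UniformIntegrable Zcheck 1 Qcheck)
    (hnonneg : ∀ᵐ ω ∂Qcheck, ∀ t, 0 ≤ Zcheck t ω)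
    (hcadlag : ∀ᵐ ω ∂Qcheck, FoellmerPair.IsCadlag fun t => Zcheck t ω)
    (hinit : ∀ᵐ ω ∂Qcheck, Zcheck 0 ω = 1) :
    (∃! Q : @Measure Ω (FoellmerPair.terminal 𝓕),
      FoellmerPair.HasDensityProcess 𝓕 Qcheck Zcheck Q) ∧
    (∀ n : ℕ, IsStoppingTime 𝓕 (FoellmerPair.hitBelow Zcheck n)) ∧
    ∀ Q : @Measure Ω (FoellmerPair.terminal 𝓕),
      FoellmerPair.HasDensityProcess 𝓕 Qcheck Zcheck Q →
      FoellmerPair.IsFoellmerPair (FoellmerPair.onTerminal 𝓕) Q (fun t ω => (Zcheck t ω)⁻¹)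
        (Qcheck.trim (FoellmerPair.terminal_le 𝓕)) (FoellmerPair.hitLimit Zcheck) ∧
      (FoellmerPair.IsLocalMartingale (fun t ω => (Zcheck t ω)⁻¹) (FoellmerPair.onTerminal 𝓕) Q ↔
        Qcheck {ω | ∃ t : ℝ≥0, FoellmerPair.hitLimit Zcheck ω = (t : WithTop ℝ≥0) ∧
          Function.leftLim (fun s => Zcheck s ω) t ≠ 0} = 0) ∧
      (Martingale (fun t ω => (Zcheck t ω)⁻¹) (FoellmerPair.onTerminal 𝓕) Q ↔
        ∀ᵐ ω ∂Qcheck, ∀ t, 0 < Zcheck t ω) := by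
  have hc : ∀ᵐ ω ∂Qcheck, ∀ t, ContinuousWithinAt (fun s => Zcheck s ω) (Ioi t) t :=
    hcadlag.mono fun ω h t => (h t).1
  obtain ⟨Q₀, hQ₀⟩ := FoellmerPair.exists_hasDensityProcess hmart hui hnonneg
  refine ⟨⟨Q₀, hQ₀, fun Q hQ => hQ.unique hmart hQ₀⟩,
    FoellmerPair.isStoppingTime_hitBelow husual hmart.stronglyAdapted hc, fun Q hQ =>
    ⟨hQ.isFoellmerPair husual hmart hnonneg hcadlag hinit, ?_,
      hQ.martingale_inv_iff husual hmart hnonneg hc hinit⟩⟩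
  rw [hQ.isLocalMartingale_inv_iff husual hmart hnonneg hcadlag hinit, ae_iff]
  simp only [not_forall, exists_prop, ne_eq]
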